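/- Consider a linear network $\dot x(t)=Ax(t)+Bu(t)$ with $n$ nodes, $A\in\mathbb{R}^{n\times n}$ and $B\in\mathbb{R}^{n\times m}$, where $x_i(t)\in\mathbb{R}$ is the state of node $i$. Assume that the inputs are nonnegative, that is, $u(t)\in\mathbb{R}^m_{\ge 0}$ for all $t\ge 0$ (with $u$ locally integrable), and that each column of $B$ is $\mathfrak e_i$ or $-\mathfrak e_i$ for some standard basis vector $\mathfrak e_i$ of $\mathbb{R}^n$. For a set of nodes $\mathcal V_s\subseteq\{1,\dots,n\}$ let $x_s$ be the vector of the states of the nodes in $\mathcal V_s$. Call $\mathcal V_s$ unilaterally reachable if, for every initial state $x(0)\in\mathbb{R}^n$ with $x_s(0)=0$ and every target $\bar x_s\in\mathbb{R}^{|\mathcal V_s|}$, there are such an input $u$ and a finite time $T\ge 0$ with $x_s(T)=\bar x_s$. Call $\mathcal V_s$ unilaterally controllable if the same holds for every initial state $x(0)\in\mathbb{R}^n$. Then, for all such $A$ and $B$ and every $\mathcal V_s$, the set $\mathcal V_s$ is unilaterally reachable if and only if it is unilaterally controllable. The equivalence also holds if reachability is only required from the initial state $x(0)=0$ of the whole network.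 On the other hand, the set of reachable states (those $\bar x\in\mathbb{R}^n$ to which $x(0)=0$ can be steered in finite time by such an input) and the set of controllable states (those $\bar x\in\mathbb{R}^n$ that can be steered to $0$ in finite time by such an input) do not coincide in general: there are $n,m$ and such $A,B$ for which the two sets differ. -/

import Mathlib

open MeasureTheory

namespace UnilateralNetwork

/-- Every column of the input matrix is a versor `e_i` or its opposite `-e_i`
(repeated columns are allowed). -/
def SignedVersorColumns {n m : ℕ} (B : Matrix (Fin n) (Fin m) ℝ) : Prop :=
  ∀ j : Fin m, ∃ i : Fin n,
    (fun k => B k j) = Pi.single i (1 : ℝ) ∨ (fun k => B k j) = -Pi.single i (1 : ℝ)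

/-- Admissible unilateral inputs `u : [0, ∞) → ℝ^m`: locally integrable on `[0, ∞)` with
nonnegative entries at all times. Values at negative times are irrelevant. -/
def NonnegInput {m : ℕ} (u : ℝ → Fin m → ℝ) : Prop :=
  (∀ t : ℝ, 0 ≤ t → IntervalIntegrable u volume 0 t) ∧
    ∀ t : ℝ, 0 ≤ t → ∀ j : Fin m, 0 ≤ u t j

/-- `x` is the (Carathéodory) solution on `[0, ∞)` of `ẋ = A x + B u` with `x 0 = x₀`. -/
def IsTrajectory {n m : ℕ} (A : Matrix (Fin n) (Fin n) ℝ) (B : Matrix (Fin n) (Fin m) ℝ)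
    (u : ℝ → Fin m → ℝ) (x₀ : Fin n → ℝ) (x : ℝ → Fin n → ℝ) : Prop :=
  ContinuousOn x (Set.Ici 0) ∧
    ∀ t : ℝ, 0 ≤ t → x t = x₀ + ∫ s in (0 : ℝ)..t, (A.mulVec (x s) + B.mulVec (u s))

/-- Some nonnegative input steers the network from the state `x₀` to the state `x₁`
in finite time. -/
def CanSteer {n m : ℕ} (A : Matrix (Fin n) (Fin n) ℝ) (B : Matrix (Fin n) (Fin m) ℝ)
    (x₀ x₁ : Fin n → ℝ) : Prop :=
  ∃ (u : ℝ → Fin m → ℝ) (x : ℝ → Fin n → ℝ) (T : ℝ),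
    NonnegInput u ∧ IsTrajectory A B u x₀ x ∧ 0 ≤ T ∧ x T = x₁

/-- Some nonnegative input steers the network from the state `x₀` in finite time to a state
whose restriction to the nodes in `S` is `y`. -/
def CanSteerNodes {n m : ℕ} (A : Matrix (Fin n) (Fin n) ℝ) (B : Matrix (Fin n) (Fin m) ℝ)
    (S : Set (Fin n)) (x₀ : Fin n → ℝ) (y : S → ℝ) : Prop :=
  ∃ x₁ : Fin n → ℝ, CanSteer A B x₀ x₁ ∧ ∀ i : S, x₁ i = y i

/-- The node subset `S` is unilaterally reachable: from every initial state of the network with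
`x_S(0) = 0`, the state `x_S` can be steered to any target. -/
def NodesReachable {n m : ℕ} (A : Matrix (Fin n) (Fin n) ℝ) (B : Matrix (Fin n) (Fin m) ℝ)
    (S : Set (Fin n)) : Prop :=
  ∀ x₀ : Fin n → ℝ, (∀ i ∈ S, x₀ i = 0) → ∀ y : S → ℝ, CanSteerNodes A B S x₀ y

/-- The variant of `NodesReachable` in which the whole network starts at rest, `x(0) = 0`. -/
def NodesReachableFromRest {n m : ℕ} (A : Matrix (Fin n) (Fin n) ℝ)
    (B : Matrix (Fin n) (Fin m) ℝ) (S : Set (Fin n)) : Prop :=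
  ∀ y : S → ℝ, CanSteerNodes A B S 0 y

/-- The node subset `S` is unilaterally controllable: from every initial state of the network,
the state `x_S` can be steered to any target. -/
def NodesControllable {n m : ℕ} (A : Matrix (Fin n) (Fin n) ℝ) (B : Matrix (Fin n) (Fin m) ℝ)
    (S : Set (Fin n)) : Prop :=
  ∀ (x₀ : Fin n → ℝ) (y : S → ℝ), CanSteerNodes A B S x₀ y

/-- The set of unilaterally reachable states of `(A, B)`: those to which the origin can be
steered. -/
def reachableStates {n m : ℕ} (A : Matrix (Fin n) (Fin n) ℝ) (B : Matrix (Fin n) (Fin m) ℝ) :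
    Set (Fin n → ℝ) :=
  {x | CanSteer A B 0 x}

/-- The set of unilaterally controllable states of `(A, B)`: those that can be steered to the
origin. -/
def controllableStates {n m : ℕ} (A : Matrix (Fin n) (Fin n) ℝ)
    (B : Matrix (Fin n) (Fin m) ℝ) : Set (Fin n → ℝ) :=
  {x | CanSteer A B x 0}

end UnilateralNetwork

/-! The state is linear in the pair (initial state, input) and nonnegative inputs form a convex
cone, so the pairs of states joined in one fixed time `T` form a convex cone (`SteersIn.add`,
`SteersIn.smul`). A network at rest can wait, so finitely many targets reached from rest share a
common time (`SteersIn.delay`); applied to plus and minus the basis vectors on `S`, this gives one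
`T` for all targets. From any `x₀`, superposing the free response on a motion from rest then
controls `x_S`. Thus reachability from rest, the weakest of the three properties, implies the
strongest. The sets of states differ already for `ẋ = u`, which can only increase. -/

namespace UnilateralNetwork

section Superposition

variable {n m : ℕ} {A : Matrix (Fin n) (Fin n) ℝ} {B : Matrix (Fin n) (Fin m) ℝ}

/-- Some nonnegative input steers the network from `x₀` to `x₁` in time exactly `T`. -/
def SteersIn (A : Matrix (Fin n) (Fin n) ℝ) (B : Matrix (Fin n) (Fin m) ℝ) (T : ℝ)
    (x₀ x₁ : Fin n → ℝ) : Prop :=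
  ∃ (u : ℝ → Fin m → ℝ) (x : ℝ → Fin n → ℝ),
    NonnegInput u ∧ IsTrajectory A B u x₀ x ∧ x T = x₁

theorem SteersIn.canSteer {T : ℝ} {x₀ x₁ : Fin n → ℝ} (hT : 0 ≤ T)
    (h : SteersIn A B T x₀ x₁) : CanSteer A B x₀ x₁ := by
  obtain ⟨u, x, hu, hx, e⟩ := h
  exact ⟨u, x, T, hu, hx, hT, e⟩

theorem intervalIntegrable_mulVec {k l : ℕ} (M : Matrix (Fin k) (Fin l) ℝ) {f : ℝ → Fin l → ℝ}
    {a b : ℝ} (hf : IntervalIntegrable f volume a b) :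
    IntervalIntegrable (fun s => M.mulVec (f s)) volume a b := by
  exact ⟨(Matrix.mulVecLin M).toContinuousLinearMap.integrable_comp hf.1,
    (Matrix.mulVecLin M).toContinuousLinearMap.integrable_comp hf.2⟩

theorem intervalIntegrable_velocity {u : ℝ → Fin m → ℝ} {x : ℝ → Fin n → ℝ} {t : ℝ}
    (hu : NonnegInput u) (hx : ContinuousOn x (Set.Ici 0)) (ht : 0 ≤ t) :
    IntervalIntegrable (fun s => A.mulVec (x s) + B.mulVec (u s)) volume 0 t := by
  refine (intervalIntegrable_mulVec A ?_).add (intervalIntegrable_mulVec B (hu.1 t ht))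
  refine (hx.mono ?_).intervalIntegrable
  rw [Set.uIcc_of_le ht]
  exact Set.Icc_subset_Ici_self

theorem SteersIn.add {T : ℝ} {x₀ x₁ y₀ y₁ : Fin n → ℝ} (hx : SteersIn A B T x₀ x₁)
    (hy : SteersIn A B T y₀ y₁) : SteersIn A B T (x₀ + y₀) (x₁ + y₁) := by
  obtain ⟨u, x, hu, ⟨hxc, hxi⟩, rfl⟩ := hx
  obtain ⟨v, y, hv, ⟨hyc, hyi⟩, rfl⟩ := hy
  refine ⟨u + v, x + y, ⟨fun t ht => (hu.1 t ht).add (hv.1 t ht),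
    fun t ht j => add_nonneg (hu.2 t ht j) (hv.2 t ht j)⟩, ⟨hxc.add hyc, fun t ht => ?_⟩, rfl⟩
  have hadd := intervalIntegral.integral_add (intervalIntegrable_velocity (A := A) (B := B) hu hxc ht)
    (intervalIntegrable_velocity (A := A) (B := B) hv hyc ht)
  have hcongr : (fun s => A.mulVec ((x + y) s) + B.mulVec ((u + v) s)) = fun s =>
      (A.mulVec (x s) + B.mulVec (u s)) + (A.mulVec (y s) + B.mulVec (v s)) := by
    funext s
    simp only [Pi.add_apply, Matrix.mulVec_add]
    abel
  rw [hcongr, hadd, Pi.add_apply, hxi t ht, hyi t ht]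
  abel

theorem SteersIn.smul {T c : ℝ} {x₀ x₁ : Fin n → ℝ} (hc : 0 ≤ c) (hx : SteersIn A B T x₀ x₁) :
    SteersIn A B T (c • x₀) (c • x₁) := by
  obtain ⟨u, x, hu, ⟨hxc, hxi⟩, rfl⟩ := hx
  refine ⟨c • u, c • x, ⟨fun t ht => (hu.1 t ht).smul c,
    fun t ht j => mul_nonneg hc (hu.2 t ht j)⟩, ⟨hxc.const_smul c, fun t ht => ?_⟩, rfl⟩
  have hcongr : (fun s => A.mulVec ((c • x) s) + B.mulVec ((c • u) s)) = fun s =>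
      c • (A.mulVec (x s) + B.mulVec (u s)) := by
    funext s
    simp only [Pi.smul_apply, Matrix.mulVec_smul, smul_add]
  rw [hcongr, intervalIntegral.integral_smul, Pi.smul_apply, hxi t ht, smul_add]

/-- The free response `exp (t A) x₀` of the network. -/
theorem exists_steersIn_free (A : Matrix (Fin n) (Fin n) ℝ) (B : Matrix (Fin n) (Fin m) ℝ)
    (T : ℝ) (x₀ : Fin n → ℝ) : ∃ x₁, SteersIn A B T x₀ x₁ := by
  let L : (Fin n → ℝ) →L[ℝ] (Fin n → ℝ) := (Matrix.mulVecLin A).toContinuousLinearMap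
  let x : ℝ → Fin n → ℝ := fun t => NormedSpace.exp (t • L) x₀
  have hd : ∀ t, HasDerivAt x (A.mulVec (x t)) t := fun t =>
    (ContinuousLinearMap.apply ℝ (Fin n → ℝ) x₀).hasFDerivAt.comp_hasDerivAt t
      (hasDerivAt_exp_smul_const' L t)
  have hc : Continuous x := continuous_iff_continuousAt.2 fun t => (hd t).continuousAt
  have hL : Continuous fun s => A.mulVec (x s) := L.continuous.comp hc
  refine ⟨x T, 0, x, ⟨fun t _ => intervalIntegrable_const, fun t _ j => le_rfl⟩,
    ⟨hc.continuousOn, fun t _ => ?_⟩, rfl⟩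
  have hftc := intervalIntegral.integral_eq_sub_of_hasDerivAt (fun s _ => hd s)
    (hL.intervalIntegrable 0 t)
  have h0 : x 0 = x₀ := by simp [x]
  simp only [Pi.zero_apply, Matrix.mulVec_zero, add_zero]
  rw [hftc, h0]
  abel

theorem steersIn_zero (T : ℝ) : SteersIn A B T 0 0 := by
  obtain ⟨x₁, h⟩ := exists_steersIn_free A B T 0
  -- Scaling by `0` makes it unnecessary to know the endpoint `x₁`.
  simpa using h.smul le_rfl

/-- Waiting at rest before applying an input. -/
theorem SteersIn.delay {T d : ℝ} {x₁ : Fin n → ℝ} (hT : 0 ≤ T) (hd : 0 ≤ d)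
    (hx : SteersIn A B T 0 x₁) : SteersIn A B (T + d) 0 x₁ := by
  obtain ⟨u, x, hu, ⟨hxc, hxi⟩, rfl⟩ := hx
  have hx0 : x 0 = 0 := by simpa using hxi 0 le_rfl
  let v : ℝ → Fin m → ℝ := fun t => if t ≤ d then 0 else u (t - d)
  -- The `max` holds the state at `x 0 = 0` while waiting and keeps the argument in `[0, ∞)`, where
  -- `x` is continuous.
  let y : ℝ → Fin n → ℝ := fun t => x (max (t - d) 0)
  have hvlt : ∀ t, t ≤ d → v t = 0 := fun t ht => if_pos ht
  have hvgt : ∀ t, d < t → v t = u (t - d) := fun t ht => if_neg ht.not_ge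
  have hylt : ∀ t, t ≤ d → y t = 0 := fun t ht => by
    simp only [y]; rw [max_eq_right (by linarith), hx0]
  have hygt : ∀ t, d ≤ t → y t = x (t - d) := fun t ht => by
    simp only [y]; rw [max_eq_left (by linarith)]
  have hyc : Continuous y :=
    hxc.comp_continuous (by fun_prop) fun t => Set.mem_Ici.2 (le_max_right _ _)
  have hvi : ∀ t, 0 ≤ t → IntervalIntegrable v volume 0 t := by
    have hbefore : ∀ t, 0 ≤ t → t ≤ d → IntervalIntegrable v volume 0 t := fun t ht htd => by
      refine (intervalIntegrable_const (c := (0 : Fin m → ℝ))).congr fun s hs => ?_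
      rw [Set.uIoc_of_le ht] at hs
      exact (hvlt s (hs.2.trans htd)).symm
    intro t ht
    rcases le_total t d with htd | htd
    · exact hbefore t ht htd
    · refine (hbefore d hd le_rfl).trans ?_
      have hshift := (hu.1 (t - d) (by linarith)).comp_sub_right d
      rw [zero_add, sub_add_cancel] at hshift
      refine hshift.congr fun s hs => ?_
      rw [Set.uIoc_of_le htd] at hs
      exact (hvgt s hs.1).symm
  have hv : NonnegInput v := by
    refine ⟨hvi, fun t ht j => ?_⟩
    rcases le_or_gt t d with htd | htd
    · simp [hvlt t htd]
    · rw [hvgt t htd]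
      exact hu.2 _ (by linarith) j
  have hbefore : ∀ t, 0 ≤ t → t ≤ d →
      ∫ s in (0 : ℝ)..t, (A.mulVec (y s) + B.mulVec (v s)) = 0 := fun t ht htd => by
    rw [intervalIntegral.integral_congr (g := fun _ => (0 : Fin n → ℝ))]
    · simp
    · intro s hs
      rw [Set.uIcc_of_le ht] at hs
      simp [hvlt s (hs.2.trans htd), hylt s (hs.2.trans htd)]
  refine ⟨v, y, hv, ⟨hyc.continuousOn, fun t ht => ?_⟩, ?_⟩
  · rw [zero_add]
    rcases le_total t d with htd | htd
    · rw [hylt t htd, hbefore t ht htd]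
    · have h1 := intervalIntegrable_velocity (A := A) (B := B) hv hyc.continuousOn hd
      have h2 := intervalIntegrable_velocity (A := A) (B := B) hv hyc.continuousOn ht
      rw [← intervalIntegral.integral_add_adjacent_intervals h1 (h1.symm.trans h2),
        hbefore d hd le_rfl, zero_add, hygt t htd, hxi (t - d) (by linarith), zero_add]
      have hshift := intervalIntegral.integral_comp_sub_right (a := d) (b := t)
        (fun s => A.mulVec (x s) + B.mulVec (u s)) d
      rw [sub_self] at hshift
      rw [← hshift]
      -- At `s = d` the input `v` is `0` instead of `u 0`, so the integrands are compared on the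
      -- half-open interval only.
      refine intervalIntegral.integral_congr_ae (Filter.Eventually.of_forall fun s hs => ?_)
      rw [Set.uIoc_of_le htd] at hs
      rw [hvgt s hs.1, hygt s hs.1.le]
  · rw [hygt _ (by linarith), add_sub_cancel_right]

theorem SteersIn.sum {ι : Type*} (s : Finset ι) {T : ℝ} {x₁ : ι → Fin n → ℝ}
    (h : ∀ i ∈ s, SteersIn A B T 0 (x₁ i)) : SteersIn A B T 0 (∑ i ∈ s, x₁ i) := by
  refine Finset.sum_induction x₁ (SteersIn A B T 0) (fun a b ha hb => ?_) (steersIn_zero T) h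
  simpa using ha.add hb

/-- A single time suffices to steer `x_S` from rest to every target. -/
theorem NodesReachableFromRest.exists_uniform_time {S : Set (Fin n)}
    (h : NodesReachableFromRest A B S) :
    ∃ T, 0 ≤ T ∧ ∀ y : S → ℝ, ∃ x₁, SteersIn A B T 0 x₁ ∧ ∀ i : S, x₁ i = y i := by
  classical
  have hr : ∀ y : S → ℝ, ∃ (T : ℝ) (x₁ : Fin n → ℝ), 0 ≤ T ∧ SteersIn A B T 0 x₁ ∧
      ∀ i : S, x₁ i = y i := fun y => by
    obtain ⟨x₁, ⟨u, x, T, hu, hx, hT, e⟩, hy⟩ := h y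
    exact ⟨T, x₁, hT, ⟨u, x, hu, hx, e⟩, hy⟩
  choose τ r hτ hs he using hr
  let p : S → S → ℝ := fun i => Pi.single i 1
  -- The times are nonnegative, so their sum bounds each of them.
  let T : ℝ := ∑ i, (τ (p i) + τ (-p i))
  have hle : ∀ i, τ (p i) + τ (-p i) ≤ T := fun i =>
    Finset.single_le_sum (f := fun i => τ (p i) + τ (-p i))
      (fun i _ => add_nonneg (hτ _) (hτ _)) (Finset.mem_univ i)
  have hall : ∀ y, τ y ≤ T → SteersIn A B T 0 (r y) := fun y hy => by
    simpa using (hs y).delay (hτ y) (sub_nonneg.2 hy)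
  refine ⟨T, Finset.sum_nonneg fun i _ => add_nonneg (hτ _) (hτ _), fun y =>
    -- Only nonnegative multiples are allowed, so each coordinate is split into its positive and
    -- negative parts.
    ⟨∑ i, (max (y i) 0 • r (p i) + max (-y i) 0 • r (-p i)), SteersIn.sum _ fun i _ => ?_,
      fun k => ?_⟩⟩
  · have hpos := (hall (p i) (by linarith [hle i, hτ (-p i)])).smul (le_max_right (y i) 0)
    have hneg := (hall (-p i) (by linarith [hle i, hτ (p i)])).smul (le_max_right (-y i) 0)
    simpa using hpos.add hneg
  · have hterm : ∀ i, max (y i) 0 * p i k + max (-y i) 0 * (-p i) k = y i * p i k := fun i => by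
      rw [Pi.neg_apply]
      rcases le_total 0 (y i) with hi | hi
      · rw [max_eq_left hi, max_eq_right (by linarith)]; ring
      · rw [max_eq_right hi, max_eq_left (by linarith)]; ring
    simp only [Finset.sum_apply, Pi.add_apply, Pi.smul_apply, smul_eq_mul, he, hterm]
    simp [p, Pi.single_apply]

theorem NodesReachableFromRest.nodesControllable {S : Set (Fin n)}
    (h : NodesReachableFromRest A B S) : NodesControllable A B S := by
  obtain ⟨T, hT, hr⟩ := h.exists_uniform_time
  intro x₀ y
  obtain ⟨z, hz⟩ := exists_steersIn_free A B T x₀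
  -- The corrected target depends on `T` through `z`, hence the need for a time independent of the
  -- target.
  obtain ⟨w, hw, hwy⟩ := hr fun i => y i - z i
  have hzw := hz.add hw
  rw [add_zero] at hzw
  exact ⟨z + w, hzw.canSteer hT, fun i => by rw [Pi.add_apply, hwy i]; ring⟩

end Superposition

/-- For the scalar integrator `ẋ = u` the state `1` can be reached from the origin. -/
theorem one_mem_reachableStates_integrator :
    (1 : Fin 1 → ℝ) ∈ reachableStates (m := 1) (0 : Matrix (Fin 1) (Fin 1) ℝ) 1 := by
  refine ⟨fun _ => 1, fun t => t • 1, 1,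
    ⟨fun t _ => intervalIntegrable_const, fun t _ j => zero_le_one⟩,
    ⟨by fun_prop, fun t _ => ?_⟩, zero_le_one, one_smul ℝ _⟩
  simp

/-- For the scalar integrator `ẋ = u` the state `1` cannot be steered to the origin. -/
theorem one_notMem_controllableStates_integrator :
    (1 : Fin 1 → ℝ) ∉ controllableStates (m := 1) (0 : Matrix (Fin 1) (Fin 1) ℝ) 1 := by
  rintro ⟨u, x, T, hu, ⟨-, hx⟩, hT, h0⟩
  have h := hx T hT
  simp only [Matrix.zero_mulVec, Matrix.one_mulVec, zero_add] at h
  have hproj := (ContinuousLinearMap.proj (R := ℝ) (φ := fun _ : Fin 1 => ℝ)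
    0).intervalIntegral_comp_comm (hu.1 T hT)
  have hnonneg : 0 ≤ ∫ s in (0 : ℝ)..T, u s 0 :=
    intervalIntegral.integral_nonneg hT fun s hs => hu.2 s hs.1 0
  simp only [ContinuousLinearMap.proj_apply] at hproj
  -- The state equation now reads `0 = 1 + ∫ u` with a nonnegative integral.
  have h1 := congrFun h 0
  rw [h0, Pi.add_apply, ← hproj, Pi.zero_apply, Pi.one_apply] at h1
  linarith

theorem signedVersorColumns_one (n : ℕ) :
    SignedVersorColumns (1 : Matrix (Fin n) (Fin n) ℝ) := fun j =>
  ⟨j, Or.inl (by funext k; simp [Matrix.one_apply, Pi.single_apply])⟩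

end UnilateralNetwork

theorem theorem3 :
    (∀ (n m : ℕ) (A : Matrix (Fin n) (Fin n) ℝ) (B : Matrix (Fin n) (Fin m) ℝ),
      UnilateralNetwork.SignedVersorColumns B →
      ∀ S : Set (Fin n),
        (UnilateralNetwork.NodesReachable A B S ↔ UnilateralNetwork.NodesControllable A B S) ∧
        (UnilateralNetwork.NodesReachableFromRest A B S ↔
          UnilateralNetwork.NodesControllable A B S)) ∧
    (∃ (n m : ℕ) (A : Matrix (Fin n) (Fin n) ℝ) (B : Matrix (Fin n) (Fin m) ℝ),
      UnilateralNetwork.SignedVersorColumns B ∧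
      UnilateralNetwork.reachableStates A B ≠ UnilateralNetwork.controllableStates A B) := by
  refine ⟨fun n m A B _ S => ⟨⟨fun h => ?_, fun h x₀ _ => h x₀⟩, fun h => ?_, fun h => h 0⟩,
    1, 1, 0, 1, UnilateralNetwork.signedVersorColumns_one 1, fun h => ?_⟩
  · exact UnilateralNetwork.NodesReachableFromRest.nodesControllable (h 0 fun _ _ => rfl)
  · exact h.nodesControllable
  · exact UnilateralNetwork.one_notMem_controllableStates_integrator
      (h ▸ UnilateralNetwork.one_mem_reachableStates_integrator)
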